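/- Let $A,C\in\mathcal M_{n\times n}(\mathbb R)$ and $B\in\mathcal M_{n\times m}(\mathbb R)$. Suppose that $(A,B)$ is controllable (for all $x_0,x_1\in\mathbb R^n$ there are a time $\tau>0$ and a control $u\in L^2(0,\tau;\mathbb R^m)$ such that the solution of $\dot x=Ax+Bu$, $x(0)=x_0$, satisfies $x(\tau)=x_1$), and that $(A,C)$ satisfies the weak Hautus test: $\operatorname{rank}\begin{bmatrix}A-i\beta I\\ C\end{bmatrix}=n$ for every $\beta\in\mathbb R$ such that $i\beta$ is an eigenvalue of $A$. For $z\in\mathbb R^n$ consider the steady problem $$\min_{(u,x)\in\mathbb R^m\times\mathbb R^n}\ \tfrac12\left[\|u\|^2+\|Cx-z\|^2\right]\quad\text{subject to}\quad 0=Ax+Bu,$$ and, for $x_0,x_1\in\mathbb R^n$ and $T>2$, the fixed endpoint problem $$\min_{u}\ \tfrac12\int_0^T\left[\|u(t)\|^2+\|Cx(t)-z\|^2\right]dt,$$ over all $u\in L^2(0,T;\mathbb R^m)$ for which the solution $x$ of $\dot x=Ax+Bu$ in $(0,T)$, $x(0)=x_0$, satisfies $x(T)=x_1$. Then, for every $z$,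 the steady problem has exactly one solution $(\overline u,\overline x)$. Moreover, there is $\mu>0$ depending only on $A,B,C$ such that for all $x_0,x_1,z\in\mathbb R^n$ there is $K>0$, depending on $A,B,C,x_0,x_1,z$ but not on $T$, with the following property: for every $T>2$ the fixed endpoint problem has an optimal control $u^T$, unique as an element of $L^2(0,T;\mathbb R^m)$ and with a representative continuous on $[0,T]$, and this representative $u^T$ and the optimal state $x^T$ satisfy $$\|u^T(t)-\overline u\|+\|x^T(t)-\overline x\|\le K\left[e^{-\mu t}+e^{-\mu(T-t)}\right]\qquad\text{for all } t\in[0,T].$$ -/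

import Mathlib

open MeasureTheory Set

noncomputable section

/-- `ℝᵏ` with the Euclidean norm. -/
abbrev Vec (k : ℕ) : Type := EuclideanSpace ℝ (Fin k)

/-- The product of a real matrix and a Euclidean vector. -/
abbrev mulV {k l : ℕ} (M : Matrix (Fin k) (Fin l) ℝ) (v : Vec l) : Vec k :=
  WithLp.toLp 2 (M.mulVec v.ofLp)

/-- `u ∈ L²(0,T;ℝᵐ)` is a control and `x` is the (absolutely continuous) solution on `[0,T]` of
`x' = A x + B u` in `(0,T)`, `x(0) = x₀`, `x(T) = x₁`, written in its integral form. The values of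
`u` and `x` outside `[0,T]` are irrelevant. -/
structure IsTrajectory {n m : ℕ} (A : Matrix (Fin n) (Fin n) ℝ) (B : Matrix (Fin n) (Fin m) ℝ)
    (T : ℝ) (x₀ x₁ : Vec n) (u : ℝ → Vec m) (x : ℝ → Vec n) : Prop where
  control_memLp : MemLp u 2 (volume.restrict (Ioo 0 T))
  state_continuous : ContinuousOn x (Icc 0 T)
  state_eq : ∀ t ∈ Icc 0 T, x t = x₀ + ∫ s in (0 : ℝ)..t, (mulV A (x s) + mulV B (u s))
  final_eq : x T = x₁

/-- `(A,B)` is controllable: every state can be steered to every other state in some finite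
time by an `L²` control. -/
def IsControllable {n m : ℕ} (A : Matrix (Fin n) (Fin n) ℝ)
    (B : Matrix (Fin n) (Fin m) ℝ) : Prop :=
  ∀ x₀ x₁ : Vec n, ∃ T : ℝ, 0 < T ∧ ∃ u x, IsTrajectory A B T x₀ x₁ u x

/-- The weak Hautus test: `rank [A - iβ I; C] = n` for every purely imaginary eigenvalue `iβ`
of `A` (including `0`, if it is an eigenvalue). -/
def WeakHautusTest {n : ℕ} (A C : Matrix (Fin n) (Fin n) ℝ) : Prop :=
  ∀ β : ℝ, (β : ℂ) * Complex.I ∈ spectrum ℂ (A.map Complex.ofReal) →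
    (Matrix.fromRows
      (A.map Complex.ofReal - ((β : ℂ) * Complex.I) • (1 : Matrix (Fin n) (Fin n) ℂ))
      (C.map Complex.ofReal)).rank = n

/-- The cost `½ ∫₀ᵀ (‖u(t)‖² + ‖C x(t) - z‖²) dt`. -/
def cost {n m : ℕ} (C : Matrix (Fin n) (Fin n) ℝ) (z : Vec n) (T : ℝ)
    (u : ℝ → Vec m) (x : ℝ → Vec n) : ℝ :=
  (1 / 2) * ∫ t in (0 : ℝ)..T, (‖u t‖ ^ 2 + ‖mulV C (x t) - z‖ ^ 2)

/-- `u` is an optimal control of the fixed endpoint problem and `x` is its optimal state. -/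
def IsOptimalPair {n m : ℕ} (A : Matrix (Fin n) (Fin n) ℝ) (B : Matrix (Fin n) (Fin m) ℝ)
    (C : Matrix (Fin n) (Fin n) ℝ) (z x₀ x₁ : Vec n) (T : ℝ)
    (u : ℝ → Vec m) (x : ℝ → Vec n) : Prop :=
  IsTrajectory A B T x₀ x₁ u x ∧
    ∀ v y, IsTrajectory A B T x₀ x₁ v y → cost C z T u x ≤ cost C z T v y

/-- The steady cost `½ (‖u‖² + ‖C x - z‖²)`. -/
def steadyCost {n m : ℕ} (C : Matrix (Fin n) (Fin n) ℝ) (z : Vec n) (u : Vec m) (x : Vec n) : ℝ :=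
  (1 / 2) * (‖u‖ ^ 2 + ‖mulV C x - z‖ ^ 2)

/-- `(u, x)` minimizes the steady cost subject to `0 = A x + B u`. -/
def IsSteadyOptimal {n m : ℕ} (A : Matrix (Fin n) (Fin n) ℝ) (B : Matrix (Fin n) (Fin m) ℝ)
    (C : Matrix (Fin n) (Fin n) ℝ) (z : Vec n) (u : Vec m) (x : Vec n) : Prop :=
  0 = mulV A x + mulV B u ∧
    ∀ (v : Vec m) (y : Vec n), 0 = mulV A y + mulV B v → steadyCost C z u x ≤ steadyCost C z v y

end

/-! The costate turns the problem into a linear two-point boundary value problem. Subtracting the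
steady state and its multiplier leaves the homogeneous flow of the `hamiltonian` H, with x
prescribed at times 0 and T. Completing squares (`cost_eq_add_of_costate`) shows that a solution of
the optimality system is the unique optimum, so neither minimizing sequences nor necessary
conditions are needed.

Everything rests on the identity d/dt ⟪p, x⟫ = -(‖B†p‖² + ‖Cx‖²). Its eigenvector version, with
controllability and the weak Hautus test, excludes imaginary eigenvalues of H
(`hamiltonian_no_imaginary_eigenvalue`), so phase space is the sum of the solutions decaying
forwards and those decaying backwards. Its integrated version shows that a trajectory with x(0) = 0
and no dissipation on an interval is zero (`eq_zero_of_hamiltonian_pairing_eq`). Hence x(0)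
determines a forward or backward decaying solution, and (x(0), x(T)) determines every solution.

`exists_turnpike_bound` makes this quantitative. For large T the decaying part is controlled by x(0)
and the growing part by x(T), up to exponentially small cross terms; for T in a compact interval,
compactness gives the constant. -/

noncomputable section

/-! ### Linear flows and their exponentially decaying solutions. -/

section Flow

variable {E : Type*} [NormedAddCommGroup E] [NormedSpace ℝ E]

/-- The solution operator of the linear equation `y' = H y`. -/
def linFlow (H : E →L[ℝ] E) (t : ℝ) : E →L[ℝ] E := NormedSpace.exp (t • H)

theorem linFlow_zero (H : E →L[ℝ] E) (v : E) : linFlow H 0 v = v := by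
  simp [linFlow]

theorem linFlow_neg_generator (H : E →L[ℝ] E) (t : ℝ) : linFlow (-H) t = linFlow H (-t) := by
  simp [linFlow]

/-- Initial values of the solutions of `y' = H y` that are `O(e^{-μt})` as `t → ∞`. -/
def decaySpace (H : E →L[ℝ] E) (μ : ℝ) : Submodule ℝ E where
  carrier := {v | ∃ K, ∀ t, 0 ≤ t → ‖linFlow H t v‖ ≤ K * Real.exp (-μ * t)}
  zero_mem' := ⟨0, by simp⟩
  add_mem' := by
    rintro v w ⟨K, hK⟩ ⟨L, hL⟩
    refine ⟨K + L, fun t ht => ?_⟩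
    rw [map_add, add_mul]
    exact (norm_add_le _ _).trans (add_le_add (hK t ht) (hL t ht))
  smul_mem' := by
    rintro c v ⟨K, hK⟩
    refine ⟨|c| * K, fun t ht => ?_⟩
    rw [map_smul, norm_smul, mul_assoc, Real.norm_eq_abs]
    exact mul_le_mul_of_nonneg_left (hK t ht) (abs_nonneg c)

/-- The weighted flows e^{μt} exp(tH) are pointwise bounded on the decay space, so uniform
boundedness replaces the constants depending on v by one. -/
theorem exists_uniform_decay [FiniteDimensional ℝ E] (H : E →L[ℝ] E) (μ : ℝ) :
    ∃ K, 0 ≤ K ∧ ∀ v ∈ decaySpace H μ, ∀ t, 0 ≤ t →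
      ‖linFlow H t v‖ ≤ K * Real.exp (-μ * t) * ‖v‖ := by
  let g : Ici (0 : ℝ) → decaySpace H μ →L[ℝ] E := fun t =>
    Real.exp (μ * t) • (linFlow H t).comp (decaySpace H μ).subtypeL
  obtain ⟨K, hK⟩ := banach_steinhaus (g := g) (by
    rintro ⟨v, K, hK⟩
    refine ⟨K, fun ⟨t, ht⟩ => ?_⟩
    have := mul_le_mul_of_nonneg_left (hK t ht) (Real.exp_nonneg (μ * t))
    rw [mul_left_comm, ← Real.exp_add] at this
    simpa [g, norm_smul] using this)
  refine ⟨K, (norm_nonneg _).trans (hK ⟨0, self_mem_Ici⟩), fun v hv t ht => ?_⟩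
  have h := (g ⟨t, ht⟩).le_of_opNorm_le (hK ⟨t, ht⟩) ⟨v, hv⟩
  have h2 : Real.exp (μ * t) * ‖linFlow H t v‖ ≤ K * ‖v‖ := by
    simpa [g, norm_smul] using h
  have := mul_le_mul_of_nonneg_left h2 (Real.exp_nonneg (-μ * t))
  rw [← mul_assoc, ← Real.exp_add] at this
  simp only [neg_mul, neg_add_cancel, Real.exp_zero, one_mul] at this ⊢
  linarith

variable [CompleteSpace E]

theorem linFlow_add (H : E →L[ℝ] E) (s t : ℝ) (v : E) :
    linFlow H (s + t) v = linFlow H s (linFlow H t v) := by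
  have : linFlow H (s + t) = linFlow H s * linFlow H t := by
    unfold linFlow
    let _ : NormedAlgebra ℚ (E →L[ℝ] E) := NormedAlgebra.restrictScalars ℚ ℝ _
    rw [add_smul, NormedSpace.exp_add_of_commute]
    exact ((Commute.refl H).smul_left s).smul_right t
  rw [this]; rfl

theorem hasDerivAt_linFlow (H : E →L[ℝ] E) (v : E) (t : ℝ) :
    HasDerivAt (fun t => linFlow H t v) (H (linFlow H t v)) t :=
  (hasDerivAt_exp_smul_const' (𝕂 := ℝ) H t).clm_apply (hasDerivAt_const t v) |>.congr_deriv
    (by simp [linFlow])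

theorem continuous_linFlow (H : E →L[ℝ] E) : Continuous (linFlow H) := by
  have : Differentiable ℝ (linFlow H) := differentiable_exp_smul_const ℝ H
  exact this.continuous

theorem analyticOnNhd_linFlow (H : E →L[ℝ] E) (v : E) :
    AnalyticOnNhd ℝ (fun t => linFlow H t v) univ := by
  intro t _
  have h1 : AnalyticAt ℝ (NormedSpace.exp : (E →L[ℝ] E) → _) (t • H) := NormedSpace.exp_analytic _
  have h2 : AnalyticAt ℝ (fun t : ℝ => t • H) t := by fun_prop
  have h3 : AnalyticAt ℝ (linFlow H) t := AnalyticAt.comp (f := fun t : ℝ => t • H) h1 h2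
  exact ((ContinuousLinearMap.apply ℝ E v).analyticAt _).comp h3

theorem eq_linFlow_of_hasDerivAt {H : E →L[ℝ] E} {y : ℝ → E}
    (hy : ∀ t, HasDerivAt y (H (y t)) t) (t : ℝ) : y t = linFlow H t (y 0) := by
  have := ODE_solution_unique_univ (v := fun _ => H) (s := fun _ => univ) (K := ‖H‖₊) (t₀ := 0)
    (f := y) (g := fun t => linFlow H t (y 0)) (fun _ => H.lipschitz.lipschitzOnWith)
    (fun t => ⟨hy t, trivial⟩) (fun t => ⟨hasDerivAt_linFlow H _ t, trivial⟩)
    (linFlow_zero H _).symm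
  exact congrFun this t

/-- An intertwining operator of two generators intertwines their flows. -/
theorem map_linFlow {F : Type*} [NormedAddCommGroup F] [NormedSpace ℝ F] [CompleteSpace F]
    {H : E →L[ℝ] E} {G : F →L[ℝ] F} (ρ : E →L[ℝ] F) (h : ∀ v, ρ (H v) = G (ρ v)) (t : ℝ) (v : E) :
    ρ (linFlow H t v) = linFlow G t (ρ v) := by
  have := eq_linFlow_of_hasDerivAt (H := G) (y := fun t => ρ (linFlow H t v)) (fun t => by
    rw [← h]
    exact ρ.hasFDerivAt.comp_hasDerivAt t (hasDerivAt_linFlow H v t)) t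
  simpa [linFlow_zero] using this

theorem linFlow_mem_decaySpace {H : E →L[ℝ] E} {μ : ℝ} {v : E} (hv : v ∈ decaySpace H μ) (s : ℝ) :
    linFlow H s v ∈ decaySpace H μ := by
  obtain ⟨K, hK⟩ := hv
  refine ⟨‖linFlow H s‖ * K, fun t ht => ?_⟩
  rw [← linFlow_add, add_comm, linFlow_add, mul_assoc]
  exact (ContinuousLinearMap.le_opNorm _ _).trans
    (mul_le_mul_of_nonneg_left (hK t ht) (norm_nonneg _))

end Flow

/-! ### Exponential dichotomy over ℂ, from generalized eigenspaces. -/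

section ComplexDichotomy

variable {V : Type*} [NormedAddCommGroup V] [NormedSpace ℂ V]

/-- Induction on the nilpotency order: e^{-lt} exp(tL)v has derivative e^{-lt} exp(tL)(L - l)v,
which the induction hypothesis bounds. The strict gap between Re l and -μ absorbs the polynomial
factors of the Jordan block. -/
theorem mem_decaySpace_of_pow_apply_eq_zero [CompleteSpace V] {L : V →L[ℂ] V} {l : ℂ} {μ : ℝ}
    (hl : l.re < -μ) (k : ℕ) {v : V} (hv : (((L : V →ₗ[ℂ] V) - l • 1) ^ k) v = 0) :
    v ∈ decaySpace (L.restrictScalars ℝ) μ := by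
  induction k generalizing v with
  | zero =>
    have : v = 0 := by simpa using hv
    rw [this]; exact Submodule.zero_mem _
  | succ k ih =>
    set H := L.restrictScalars ℝ with hH
    obtain ⟨K, hK⟩ := ih (v := L v - l • v) (by simpa [pow_succ] using hv)
    have hK0 : 0 ≤ K := by simpa [linFlow_zero] using (norm_nonneg _).trans (hK 0 le_rfl)
    set σ : ℝ := -l.re with hσ
    have hσμ : 0 < σ - μ := by linarith
    let f : ℝ → V := fun t => Complex.exp (-l * t) • linFlow H t v
    have hcomm : ∀ t, H (linFlow H t v) - l • linFlow H t v = linFlow H t (L v - l • v) := by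
      intro t
      have := map_linFlow (H := H) (G := H) ((L - l • 1).restrictScalars ℝ)
        (fun v => by simp [hH]) t v
      simpa [hH] using this
    have hf : ∀ t : ℝ, HasDerivAt f (Complex.exp (-l * t) • linFlow H t (L v - l • v)) t := by
      intro t
      have h1 : HasDerivAt (fun t : ℝ => Complex.exp (-l * t)) (Complex.exp (-l * t) * -l) t := by
        have : HasDerivAt (fun t : ℝ => -l * (t : ℂ)) (-l) t := by
          simpa using (Complex.ofRealCLM.hasDerivAt (x := t)).const_mul (-l)
        exact this.cexp
      refine (h1.smul (hasDerivAt_linFlow H v t)).congr_deriv ?_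
      rw [← hcomm, smul_sub, mul_smul, neg_smul, smul_neg, sub_eq_add_neg]
    have hexp : ∀ t : ℝ, ‖Complex.exp (-l * t)‖ = Real.exp (σ * t) := by
      intro t; simp [Complex.norm_exp, hσ]
    refine ⟨‖v‖ + K / (σ - μ), fun t ht => ?_⟩
    have hB := image_norm_le_of_norm_deriv_right_le_deriv_boundary (f := f) (a := 0) (b := t)
      (B := fun t => ‖v‖ + K / (σ - μ) * Real.exp ((σ - μ) * t))
      (B' := fun t => K * Real.exp ((σ - μ) * t))
      (fun t _ => (hf t).continuousAt.continuousWithinAt) (fun t _ => (hf t).hasDerivWithinAt)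
      (by simp [f, linFlow_zero]; positivity)
      (fun t => by
        have h1 : HasDerivAt (fun t : ℝ => (σ - μ) * t) (σ - μ) t := by
          simpa using (hasDerivAt_id t).const_mul (σ - μ)
        refine ((h1.exp.const_mul (K / (σ - μ))).const_add ‖v‖).congr_deriv ?_
        field_simp)
      (fun s hs => by
        rw [norm_smul, hexp]
        calc Real.exp (σ * s) * ‖linFlow H s (L v - l • v)‖
            ≤ Real.exp (σ * s) * (K * Real.exp (-μ * s)) :=
              mul_le_mul_of_nonneg_left (hK s hs.1) (Real.exp_nonneg _)
          _ = K * Real.exp ((σ - μ) * s) := by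
              rw [mul_left_comm, ← Real.exp_add]; ring_nf)
      (right_mem_Icc.2 ht)
    simp only [f, norm_smul, hexp] at hB
    have h2 := mul_le_mul_of_nonneg_left hB (Real.exp_nonneg (-σ * t))
    rw [← mul_assoc, ← Real.exp_add, mul_add, mul_left_comm, ← Real.exp_add] at h2
    have e1 : -σ * t + σ * t = 0 := by ring
    have e2 : -σ * t + (σ - μ) * t = -μ * t := by ring
    rw [e1, e2, Real.exp_zero, one_mul] at h2
    have h3 : Real.exp (-σ * t) ≤ Real.exp (-μ * t) := Real.exp_le_exp.2 (by nlinarith)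
    nlinarith [norm_nonneg v]

/-- The spectrum is finite, so |Re l| ≥ a > 0 on it, and the rate a/2 leaves a strict gap. Each
generalized eigenspace decays in the time direction given by the sign of Re l. -/
theorem exists_decaySpace_sup_eq_top_complex [FiniteDimensional ℂ V] (L : V →L[ℂ] V)
    (hL : ∀ (β : ℝ) (v : V), L v = (Complex.I * β) • v → v = 0) :
    ∃ μ, 0 < μ ∧
      decaySpace (L.restrictScalars ℝ) μ ⊔ decaySpace (-L.restrictScalars ℝ) μ = ⊤ := by
  have := FiniteDimensional.complete ℂ V
  set f : Module.End ℂ V := (L : V →ₗ[ℂ] V) with hf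
  obtain ⟨a, ha, hmin⟩ := (Module.End.finite_hasEigenvalue f).isCompact.exists_forall_le'
    (f := fun l : ℂ => |l.re|) (a := 0) (by fun_prop) (by
      intro l hl
      obtain ⟨v, hv⟩ := hl.exists_hasEigenvector
      refine abs_pos.2 fun h0 => hv.2 (hL l.im v ?_)
      have : f v = l • v := hv.apply_eq_smul
      rw [show L v = f v from rfl, this]
      congr 1
      apply Complex.ext <;> simp [h0])
  refine ⟨a / 2, by positivity, ?_⟩
  rw [eq_top_iff]
  intro v _
  have hv : v ∈ ⨆ l, f.maxGenEigenspace l := by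
    rw [Module.End.iSup_maxGenEigenspace_eq_top]; trivial
  refine Submodule.iSup_induction _ (motive := fun v => v ∈ decaySpace (L.restrictScalars ℝ) (a / 2) ⊔
    decaySpace (-L.restrictScalars ℝ) (a / 2)) hv ?_ (Submodule.zero_mem _)
    (fun _ _ => Submodule.add_mem _)
  intro l v hv
  obtain ⟨k, hk⟩ := (Module.End.mem_maxGenEigenspace f l v).1 hv
  by_cases hl : f.HasEigenvalue l
  · have h1 := hmin l hl
    rcases le_abs.1 h1 with h | h
    · refine Submodule.mem_sup_right ?_
      refine mem_decaySpace_of_pow_apply_eq_zero (L := -L) (l := -l) (k := k) ?_ ?_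
      · simp; linarith
      · have : ((-L : V →L[ℂ] V) : V →ₗ[ℂ] V) - (-l) • 1 = -(f - l • (1 : Module.End ℂ V)) := by
          ext x; simp [hf]; abel
        rw [this, neg_pow, Module.End.mul_apply, hk, map_zero]
    · refine Submodule.mem_sup_left ?_
      exact mem_decaySpace_of_pow_apply_eq_zero (l := l) (k := k) (by linarith) hk
  · have hinj : Function.Injective (f - l • (1 : Module.End ℂ V)) := by
      rw [Module.End.hasEigenvalue_iff, not_not, Module.End.eigenspace_def] at hl
      exact LinearMap.ker_eq_bot.1 hl
    have : v = 0 := by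
      have h2 : Function.Injective ⇑((f - l • (1 : Module.End ℂ V)) ^ k) := by
        rw [Module.End.coe_pow]; exact hinj.iterate k
      exact h2 (by rw [hk, map_zero])
    rw [this]; exact Submodule.zero_mem _

end ComplexDichotomy

/-! ### Descent of the dichotomy to real systems. -/

section RealDichotomy

variable {E : Type*} [NormedAddCommGroup E] [NormedSpace ℝ E] [FiniteDimensional ℝ E]

/-- A linear system without purely imaginary eigenvalues has an exponential dichotomy. -/
theorem exists_decaySpace_sup_eq_top (H : E →L[ℝ] E)
    (hH : ∀ (β : ℝ) (v w : E), H v = -β • w → H w = β • v → v = 0 ∧ w = 0) :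
    ∃ μ, 0 < μ ∧ decaySpace H μ ⊔ decaySpace (-H) μ = ⊤ := by
  have := FiniteDimensional.complete ℝ E
  let b := Module.finBasis ℝ E
  let d := Module.finrank ℝ E
  let M : Matrix (Fin d) (Fin d) ℝ := LinearMap.toMatrix b b (H : E →ₗ[ℝ] E)
  let L : (Fin d → ℂ) →L[ℂ] (Fin d → ℂ) :=
    LinearMap.toContinuousLinearMap (Matrix.toLin' (M.map Complex.ofReal))
  -- Real part in the basis `b`: it intertwines L with H and is onto, so it carries the complex
  -- splitting to E. Applied to v and -iv it yields the real and imaginary parts of v.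
  let ρ : (Fin d → ℂ) →L[ℝ] E :=
    ∑ i, (Complex.reCLM.comp (ContinuousLinearMap.proj i)).smulRight (b i)
  have hρ : ∀ v, ρ v = ∑ i, (v i).re • b i := fun v => by simp [ρ]
  have hLρ : ∀ v, ρ (L v) = H (ρ v) := by
    intro v
    have hb : ∀ j, H (b j) = ∑ i, M i j • b i := fun j => by
      rw [← b.sum_repr (H (b j))]
      simp [M, LinearMap.toMatrix_apply]
    have : ∀ i, (L v i).re = ∑ j, M i j * (v j).re := fun i => by
      simp [L, Matrix.mulVec, dotProduct, Complex.re_sum]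
    simp only [hρ, this, map_sum, map_smul, hb, Finset.sum_smul, Finset.smul_sum, smul_smul]
    rw [Finset.sum_comm]
    simp only [mul_comm]
  have hρ0 : ∀ v, ρ v = 0 → ∀ i, (v i).re = 0 := fun v hv =>
    Fintype.linearIndependent_iff.1 b.linearIndependent _ ((hρ v).symm.trans hv)
  obtain ⟨μ, hμ, hsup⟩ := exists_decaySpace_sup_eq_top_complex L (by
    intro β v hv
    have hI : L (-Complex.I • v) = (β : ℂ) • v := by
      rw [map_smul, hv, smul_smul, ← mul_assoc]; simp
    have hre : ∀ (c : ℝ) (w : Fin d → ℂ), ρ ((c : ℂ) • w) = c • ρ w := fun c w => by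
      rw [← map_smul]; congr 1
    have h := hH β (ρ v) (ρ (-Complex.I • v))
      (by
        rw [← hLρ, hv, ← hre, smul_smul]
        congr 2; push_cast; ring)
      (by rw [← hLρ, hI, hre])
    ext i
    have h1 := hρ0 _ h.1 i
    have h2 := hρ0 _ h.2 i
    apply Complex.ext
    · simpa using h1
    · simpa using h2)
  refine ⟨μ, hμ, ?_⟩
  have hmap : ∀ (G : E →L[ℝ] E) (N : (Fin d → ℂ) →L[ℝ] (Fin d → ℂ)), (∀ v, ρ (N v) = G (ρ v)) →
      ∀ v ∈ decaySpace N μ, ρ v ∈ decaySpace G μ := by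
    rintro G N h v ⟨K, hK⟩
    refine ⟨‖ρ‖ * K, fun t ht => ?_⟩
    rw [← map_linFlow ρ h, mul_assoc]
    exact (ρ.le_opNorm _).trans (mul_le_mul_of_nonneg_left (hK t ht) (norm_nonneg _))
  rw [eq_top_iff]
  intro e _
  obtain ⟨v, rfl⟩ : ∃ v, ρ v = e :=
    ⟨fun i => (b.repr e i : ℂ), by rw [hρ]; simp⟩
  have hv : v ∈ decaySpace (L.restrictScalars ℝ) μ ⊔ decaySpace (-L.restrictScalars ℝ) μ := by
    rw [hsup]; trivial
  obtain ⟨x, hx, y, hy, rfl⟩ := Submodule.mem_sup.1 hv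
  rw [map_add]
  exact Submodule.add_mem_sup (hmap _ _ (fun v => by simpa using hLρ v) _ hx)
    (hmap _ _ (fun v => by simpa using hLρ v) _ hy)

end RealDichotomy

/-! ### The Hamiltonian flow and its energy pairing. -/

section Hamiltonian

open Filter Topology ContinuousLinearMap

open scoped InnerProductSpace

variable {X U Z : Type*} [NormedAddCommGroup X] [InnerProductSpace ℝ X] [FiniteDimensional ℝ X]
  [NormedAddCommGroup U] [InnerProductSpace ℝ U] [CompleteSpace U]
  [NormedAddCommGroup Z] [InnerProductSpace ℝ Z] [CompleteSpace Z]

/-- The adjoint system `q' = -A† q` observed through `B†` is observable. -/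
def AdjointObservable [CompleteSpace X] (A : X →L[ℝ] X) (B : U →L[ℝ] X) : Prop :=
  ∀ q : ℝ → X, (∀ t, HasDerivAt q (-(adjoint A (q t))) t) → (∀ t, adjoint B (q t) = 0) → q 0 = 0

/-- No purely imaginary eigenvalue of `A` is unobservable through `C`; an eigenvector
`x + i y` for `i β` is written in real coordinates. -/
def ImaginaryObservable (A : X →L[ℝ] X) (C : X →L[ℝ] Z) : Prop :=
  ∀ (β : ℝ) (x y : X), A x = -β • y → A y = β • x → C x = 0 → C y = 0 → x = 0 ∧ y = 0

variable [CompleteSpace X]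

/-- The Hamiltonian generator `(x, p) ↦ (A x - B B† p, -C† C x - A† p)` of the optimality system. -/
def hamiltonian (A : X →L[ℝ] X) (B : U →L[ℝ] X) (C : X →L[ℝ] Z) : X × X →L[ℝ] X × X :=
  ((A.comp (fst ℝ X X)) - (B.comp (adjoint B)).comp (snd ℝ X X)).prod
    (-((adjoint C).comp C).comp (fst ℝ X X) - (adjoint A).comp (snd ℝ X X))

variable {A : X →L[ℝ] X} {B : U →L[ℝ] X} {C : X →L[ℝ] Z}

omit [FiniteDimensional ℝ X] in
theorem hamiltonian_apply (w : X × X) : hamiltonian A B C w =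
    (A w.1 - B (adjoint B w.2), -(adjoint C (C w.1)) - adjoint A w.2) := by
  simp [hamiltonian]

omit [FiniteDimensional ℝ X] in
theorem inner_control_term (p q : X) :
    ⟪p, B (adjoint B q)⟫_ℝ = ⟪adjoint B p, adjoint B q⟫_ℝ := by
  rw [adjoint_inner_left]

omit [FiniteDimensional ℝ X] in
-- On the span of p and q the adjoint flow is a rotation, so cos(βt)p - sin(βt)q is an unobserved
-- solution starting at p.
theorem AdjointObservable.eq_zero_of_rotation (hB : AdjointObservable A B) {β : ℝ} {p q : X}
    (hp : adjoint A p = β • q) (hq : adjoint A q = -β • p) (hBp : adjoint B p = 0)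
    (hBq : adjoint B q = 0) : p = 0 := by
  have hβ : ∀ t : ℝ, HasDerivAt (fun t : ℝ => β * t) β t := fun t => by
    simpa using (hasDerivAt_id t).const_mul β
  have := hB (fun t => Real.cos (β * t) • p - Real.sin (β * t) • q)
    (fun t => by
      refine (((hβ t).cos.smul_const p).sub ((hβ t).sin.smul_const q)).congr_deriv ?_
      rw [map_sub, map_smul, map_smul, hp, hq]
      module)
    (fun t => by rw [map_sub, map_smul, map_smul, hBp, hBq]; simp)
  simpa using this

omit [FiniteDimensional ℝ X] in
-- Pairing the state equations with p and the costate equations with x cancels A and leaves a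
-- vanishing sum of squares, so B†p = 0 and Cx = 0. The system then decouples: `hC` kills the state
-- and `hB` the costate.
theorem hamiltonian_no_imaginary_eigenvalue (hB : AdjointObservable A B)
    (hC : ImaginaryObservable A C) (β : ℝ) (v w : X × X)
    (hv : hamiltonian A B C v = -β • w) (hw : hamiltonian A B C w = β • v) : v = 0 ∧ w = 0 := by
  obtain ⟨x₁, p₁⟩ := v
  obtain ⟨x₂, p₂⟩ := w
  simp only [hamiltonian_apply, Prod.smul_mk, Prod.mk.injEq] at hv hw
  obtain ⟨e1, e2⟩ := hv
  obtain ⟨e3, e4⟩ := hw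
  have i1 := congrArg (fun y => ⟪p₁, y⟫_ℝ) e1
  have i2 := congrArg (fun y => ⟪y, x₁⟫_ℝ) e2
  have i3 := congrArg (fun y => ⟪p₂, y⟫_ℝ) e3
  have i4 := congrArg (fun y => ⟪y, x₂⟫_ℝ) e4
  simp only [inner_sub_right, inner_sub_left, inner_neg_left, inner_smul_right,
    adjoint_inner_left A, adjoint_inner_left C, inner_control_term, real_inner_self_eq_norm_sq,
    real_inner_smul_left]
    at i1 i2 i3 i4
  have c1 : ‖adjoint B p₁‖ ^ 2 + ‖adjoint B p₂‖ ^ 2 + ‖C x₁‖ ^ 2 + ‖C x₂‖ ^ 2 = 0 := by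
    linarith
  have n1 := sq_nonneg ‖adjoint B p₁‖
  have n2 := sq_nonneg ‖adjoint B p₂‖
  have n3 := sq_nonneg ‖C x₁‖
  have n4 := sq_nonneg ‖C x₂‖
  have z1 : adjoint B p₁ = 0 := by
    have : ‖adjoint B p₁‖ ^ 2 = 0 := by linarith
    simpa using this
  have z2 : adjoint B p₂ = 0 := by
    have : ‖adjoint B p₂‖ ^ 2 = 0 := by linarith
    simpa using this
  have z3 : C x₁ = 0 := by
    have : ‖C x₁‖ ^ 2 = 0 := by linarith
    simpa using this
  have z4 : C x₂ = 0 := by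
    have : ‖C x₂‖ ^ 2 = 0 := by linarith
    simpa using this
  simp only [z1, z2, z3, z4, map_zero, neg_zero, zero_sub, sub_zero] at e1 e2 e3 e4
  obtain ⟨rfl, rfl⟩ := hC β x₁ x₂ e1 e3 z3 z4
  have a1 : adjoint A p₁ = β • p₂ := by rw [← neg_inj, e2, neg_smul]
  have a2 : adjoint A p₂ = -β • p₁ := by rw [← neg_inj, e4, neg_smul, neg_neg]
  have b1 := hB.eq_zero_of_rotation a1 a2 z1 z2
  have b2 := hB.eq_zero_of_rotation (β := -β) (p := p₂) (q := p₁) a2 (by rw [a1, neg_neg]) z2 z1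
  simp [b1, b2]

omit [FiniteDimensional ℝ X] in
theorem hasDerivAt_hamiltonian_fst (w : X × X) (t : ℝ) :
    HasDerivAt (fun t => (linFlow (hamiltonian A B C) t w).1)
      (A (linFlow (hamiltonian A B C) t w).1 -
        B (adjoint B (linFlow (hamiltonian A B C) t w).2)) t := by
  have := (fst ℝ X X).hasFDerivAt.comp_hasDerivAt t (hasDerivAt_linFlow (hamiltonian A B C) w t)
  simpa [hamiltonian_apply, Function.comp_def] using this

omit [FiniteDimensional ℝ X] in
theorem hasDerivAt_hamiltonian_snd (w : X × X) (t : ℝ) :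
    HasDerivAt (fun t => (linFlow (hamiltonian A B C) t w).2)
      (-(adjoint C (C (linFlow (hamiltonian A B C) t w).1)) -
        adjoint A (linFlow (hamiltonian A B C) t w).2) t := by
  have := (snd ℝ X X).hasFDerivAt.comp_hasDerivAt t (hasDerivAt_linFlow (hamiltonian A B C) w t)
  simpa [hamiltonian_apply, Function.comp_def] using this

omit [FiniteDimensional ℝ X] in
theorem hasDerivAt_hamiltonian_pairing (w : X × X) (t : ℝ) :
    HasDerivAt (fun t => ⟪(linFlow (hamiltonian A B C) t w).2,
        (linFlow (hamiltonian A B C) t w).1⟫_ℝ)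
      (-(‖adjoint B (linFlow (hamiltonian A B C) t w).2‖ ^ 2 +
        ‖C (linFlow (hamiltonian A B C) t w).1‖ ^ 2)) t := by
  refine ((hasDerivAt_hamiltonian_snd w t).inner ℝ (hasDerivAt_hamiltonian_fst w t)).congr_deriv ?_
  simp only [inner_sub_right, inner_sub_left, inner_neg_left,
    adjoint_inner_left A, adjoint_inner_left C, inner_control_term, real_inner_self_eq_norm_sq]
  ring

omit [FiniteDimensional ℝ X] in
theorem antitone_hamiltonian_pairing (w : X × X) :
    Antitone (fun t => ⟪(linFlow (hamiltonian A B C) t w).2,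
        (linFlow (hamiltonian A B C) t w).1⟫_ℝ) :=
  antitone_of_hasDerivAt_nonpos (fun t => hasDerivAt_hamiltonian_pairing w t)
    (fun t => neg_nonpos.2 (by positivity))

omit [FiniteDimensional ℝ X] in
/-- A Hamiltonian trajectory that starts with zero state and dissipates no energy on an interval
vanishes. -/
theorem eq_zero_of_hamiltonian_pairing_eq (hB : AdjointObservable A B) {w : X × X}
    (hw : w.1 = 0) {a b : ℝ} (hab : a < b)
    (h : ⟪(linFlow (hamiltonian A B C) a w).2, (linFlow (hamiltonian A B C) a w).1⟫_ℝ =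
      ⟪(linFlow (hamiltonian A B C) b w).2, (linFlow (hamiltonian A B C) b w).1⟫_ℝ) : w = 0 := by
  set y : ℝ → X × X := fun t => linFlow (hamiltonian A B C) t w with hy
  have hanti := antitone_hamiltonian_pairing (A := A) (B := B) (C := C) w
  have hconst : ∀ t ∈ Icc a b, ⟪(y t).2, (y t).1⟫_ℝ = ⟪(y a).2, (y a).1⟫_ℝ := fun t ht =>
    le_antisymm (hanti ht.1) (h.le.trans (hanti ht.2))
  have hdiss : ∀ t ∈ Ioo a b, adjoint B (y t).2 = 0 ∧ C (y t).1 = 0 := by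
    intro t ht
    have h0 : HasDerivAt (fun t => ⟪(y t).2, (y t).1⟫_ℝ) 0 t := by
      refine (hasDerivAt_const t ⟪(y a).2, (y a).1⟫_ℝ).congr_of_eventuallyEq ?_
      filter_upwards [Ioo_mem_nhds ht.1 ht.2] with s hs
      exact hconst s (Ioo_subset_Icc_self hs)
    have h1 := h0.unique (hasDerivAt_hamiltonian_pairing w t)
    have n1 := sq_nonneg ‖adjoint B (y t).2‖
    have n2 := sq_nonneg ‖C (y t).1‖
    have h2 : ‖adjoint B (y t).2‖ ^ 2 = 0 := by linarith
    have h3 : ‖C (y t).1‖ ^ 2 = 0 := by linarith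
    exact ⟨by simpa using h2, by simpa using h3⟩
  let obs : X × X →L[ℝ] U × Z :=
    ((adjoint B).comp (snd ℝ X X)).prod (C.comp (fst ℝ X X))
  -- Analyticity extends the vanishing of B†p and Cx from (a, b) to all times; in particular time 0
  -- need not lie in the interval.
  have hobs : (fun t => obs (y t)) = fun _ => 0 := by
    refine AnalyticOnNhd.eq_of_eventuallyEq (𝕜 := ℝ) (z₀ := (a + b) / 2) (fun t _ => ?_)
      analyticOnNhd_const ?_
    · exact (obs.analyticAt _).comp (analyticOnNhd_linFlow (hamiltonian A B C) w t trivial)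
    · filter_upwards [Ioo_mem_nhds (show a < (a + b) / 2 by linarith)
        (show (a + b) / 2 < b by linarith)] with s hs
      obtain ⟨h1, h2⟩ := hdiss s hs
      simp [obs, h1, h2]
  have hBy : ∀ t, adjoint B (y t).2 = 0 := fun t => congrArg Prod.fst (congrFun hobs t)
  have hCy : ∀ t, C (y t).1 = 0 := fun t => congrArg Prod.snd (congrFun hobs t)
  have hy0 : y 0 = w := linFlow_zero _ _
  have hp : (y 0).2 = 0 := by
    refine hB (fun t => (y t).2) (fun t => ?_) hBy
    have := hasDerivAt_hamiltonian_snd (A := A) (B := B) (C := C) w t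
    rw [show C (linFlow (hamiltonian A B C) t w).1 = 0 from hCy t] at this
    simpa using this
  rw [hy0] at hp
  exact Prod.ext hw hp

omit [FiniteDimensional ℝ X] [CompleteSpace X] in
theorem abs_pairing_le (w : X × X) : |⟪w.2, w.1⟫_ℝ| ≤ ‖w‖ ^ 2 := by
  refine (abs_real_inner_le_norm _ _).trans ?_
  rw [sq]
  exact mul_le_mul (_root_.norm_snd_le w) (_root_.norm_fst_le w) (norm_nonneg _) (norm_nonneg _)

omit [FiniteDimensional ℝ X] [CompleteSpace X] in
theorem tendsto_pairing_of_mem_decaySpace {H : X × X →L[ℝ] X × X} {μ : ℝ} (hμ : 0 < μ)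
    {w : X × X} (hw : w ∈ decaySpace H μ) :
    Tendsto (fun t => ⟪(linFlow H t w).2, (linFlow H t w).1⟫_ℝ) atTop (𝓝 0) := by
  obtain ⟨K, hK⟩ := hw
  have h1 : Tendsto (fun t : ℝ => (K * Real.exp (-μ * t)) ^ 2) atTop (𝓝 0) := by
    have : Tendsto (fun t : ℝ => Real.exp (-μ * t)) atTop (𝓝 0) :=
      Real.tendsto_exp_atBot.comp (tendsto_id.const_mul_atTop_of_neg (neg_lt_zero.2 hμ))
    simpa using (this.const_mul K).pow 2
  refine squeeze_zero_norm' ?_ h1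
  filter_upwards [eventually_ge_atTop 0] with t ht
  rw [Real.norm_eq_abs]
  exact (abs_pairing_le _).trans (pow_le_pow_left₀ (norm_nonneg _) (hK t ht) 2)

omit [FiniteDimensional ℝ X] in
-- The pairing is antitone, zero at time 0 and tends to zero at infinity, hence constant on [0, 1].
theorem eq_zero_of_mem_stable (hB : AdjointObservable A B) {μ : ℝ} (hμ : 0 < μ)
    {w : X × X} (hw : w ∈ decaySpace (hamiltonian A B C) μ) (h0 : w.1 = 0) : w = 0 := by
  refine eq_zero_of_hamiltonian_pairing_eq (C := C) hB h0 zero_lt_one (le_antisymm ?_ ?_)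
  · rw [linFlow_zero, h0, inner_zero_right]
    exact (antitone_hamiltonian_pairing w).le_of_tendsto (tendsto_pairing_of_mem_decaySpace hμ hw) 1
  · exact antitone_hamiltonian_pairing w zero_le_one

omit [FiniteDimensional ℝ X] in
theorem eq_zero_of_mem_unstable (hB : AdjointObservable A B) {μ : ℝ} (hμ : 0 < μ)
    {w : X × X} (hw : w ∈ decaySpace (-hamiltonian A B C) μ) (h0 : w.1 = 0) : w = 0 := by
  refine eq_zero_of_hamiltonian_pairing_eq (C := C) hB h0 (neg_one_lt_zero (R := ℝ))
    (le_antisymm ?_ ?_)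
  · have h1 := tendsto_pairing_of_mem_decaySpace hμ hw
    simp only [linFlow_neg_generator] at h1
    have hmono := (antitone_hamiltonian_pairing (A := A) (B := B) (C := C) w).comp
      (fun a b (h : a ≤ b) => neg_le_neg h)
    rw [linFlow_zero, h0, inner_zero_right]
    exact hmono.ge_of_tendsto h1 1
  · exact antitone_hamiltonian_pairing w (neg_nonpos.2 zero_le_one)

/-! ### The two-point boundary value problem and its uniform bounds. -/

/-- The boundary operator `w ↦ (x(0), x(T))` of the Hamiltonian system. -/
def boundaryMap (A : X →L[ℝ] X) (B : U →L[ℝ] X) (C : X →L[ℝ] Z) (T : ℝ) : X × X →L[ℝ] X × X :=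
  (fst ℝ X X).prod ((fst ℝ X X).comp (linFlow (hamiltonian A B C) T))

omit [FiniteDimensional ℝ X] in
theorem boundaryMap_apply (T : ℝ) (w : X × X) :
    boundaryMap A B C T w = (w.1, (linFlow (hamiltonian A B C) T w).1) := rfl

omit [FiniteDimensional ℝ X] in
theorem boundaryMap_injective (hB : AdjointObservable A B) {T : ℝ} (hT : 0 < T) :
    Function.Injective (boundaryMap A B C T) := by
  rw [injective_iff_map_eq_zero]
  intro w hw
  rw [boundaryMap_apply, Prod.mk_eq_zero] at hw
  refine eq_zero_of_hamiltonian_pairing_eq (C := C) hB hw.1 hT ?_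
  rw [linFlow_zero, hw.1, hw.2, inner_zero_right, inner_zero_right]

theorem boundaryMap_surjective (hB : AdjointObservable A B) {T : ℝ} (hT : 0 < T) :
    Function.Surjective (boundaryMap A B C T) :=
  LinearMap.injective_iff_surjective.1
    (show Function.Injective (boundaryMap A B C T : X × X →ₗ[ℝ] X × X) from
      boundaryMap_injective hB hT)

theorem hamiltonian_surjective (hB : AdjointObservable A B) (hC : ImaginaryObservable A C) :
    Function.Surjective (hamiltonian A B C) := by
  refine LinearMap.injective_iff_surjective.1
    (show Function.Injective (hamiltonian A B C : X × X →ₗ[ℝ] X × X) from ?_)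
  rw [injective_iff_map_eq_zero]
  intro w hw
  exact (hamiltonian_no_imaginary_eigenvalue hB hC 0 w w (by simpa using hw) (by simpa using hw)).1

theorem exists_antilipschitz_bound {E F : Type*} [NormedAddCommGroup E] [NormedSpace ℝ E]
    [FiniteDimensional ℝ E] [NormedAddCommGroup F] [NormedSpace ℝ F] (S : Submodule ℝ E)
    (f : E →L[ℝ] F) (hf : ∀ v ∈ S, f v = 0 → v = 0) :
    ∃ c, 0 < c ∧ ∀ v ∈ S, c * ‖v‖ ≤ ‖f v‖ := by
  obtain ⟨K, hK, h⟩ := LinearMap.exists_antilipschitzWith ((f : E →ₗ[ℝ] F).comp S.subtype)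
    (LinearMap.ker_eq_bot'.2 fun v hv => Subtype.ext (hf v v.2 hv))
  have hK' : (0 : ℝ) < K := hK
  refine ⟨(K : ℝ)⁻¹, inv_pos.2 hK', fun v hv => ?_⟩
  have := h.le_mul_norm (x := (⟨v, hv⟩ : S))
  rw [inv_mul_le_iff₀ hK']
  simpa using this

/-- The boundary operators are bounded below uniformly on compact sets of times. -/
theorem exists_boundaryMap_lower_bound (hB : AdjointObservable A B) {T₁ T₂ : ℝ} (hT₁ : 0 < T₁) :
    ∃ c, 0 < c ∧ ∀ T ∈ Icc T₁ T₂, ∀ w, c * ‖w‖ ≤ ‖boundaryMap A B C T w‖ := by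
  have hcont : Continuous fun q : ℝ × (X × X) => ‖boundaryMap A B C q.1 q.2‖ := by
    have h1 : Continuous fun q : ℝ × (X × X) => linFlow (hamiltonian A B C) q.1 q.2 :=
      ((continuous_linFlow _).comp continuous_fst).clm_apply continuous_snd
    simp only [boundaryMap_apply]
    fun_prop
  obtain ⟨c, hc, h⟩ := ((isCompact_Icc (a := T₁) (b := T₂)).prod
    (isCompact_sphere (0 : X × X) 1)).exists_forall_le' hcont.continuousOn (a := 0) (by
      rintro ⟨T, w⟩ ⟨hT, hw⟩
      refine norm_pos_iff.2 fun h0 => ?_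
      have : w = 0 := boundaryMap_injective hB (hT₁.trans_le hT.1) (by simpa using h0)
      simp [this] at hw)
  refine ⟨c, hc, fun T hT w => ?_⟩
  rcases eq_or_ne w 0 with rfl | hw
  · simp
  · have hw' : 0 < ‖w‖ := norm_pos_iff.2 hw
    have := h (T, ‖w‖⁻¹ • w) ⟨hT, by simp [norm_smul, hw'.ne']⟩
    simp only [map_smul, norm_smul, norm_inv, norm_norm] at this
    rwa [inv_mul_eq_div, le_div_iff₀ hw'] at this

/-- Turnpike estimate for the Hamiltonian two-point boundary value problem, with constants that
do not depend on the horizon. -/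
theorem exists_turnpike_bound (hB : AdjointObservable A B) (hC : ImaginaryObservable A C) {T₁ : ℝ}
    (hT₁ : 0 < T₁) :
    ∃ μ, 0 < μ ∧ ∃ K, 0 ≤ K ∧ ∀ T, T₁ ≤ T → ∀ w : X × X, ∀ t ∈ Icc 0 T,
      ‖linFlow (hamiltonian A B C) t w‖ ≤
        K * ‖boundaryMap A B C T w‖ * (Real.exp (-μ * t) + Real.exp (-μ * (T - t))) := by
  set H := hamiltonian A B C with hH
  obtain ⟨μ, hμ, hsup⟩ := exists_decaySpace_sup_eq_top H
    (hamiltonian_no_imaginary_eigenvalue hB hC)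
  refine ⟨μ, hμ, ?_⟩
  obtain ⟨Ks, hKs, hs⟩ := exists_uniform_decay H μ
  obtain ⟨Ku, hKu, hu⟩ := exists_uniform_decay (-H) μ
  simp only [linFlow_neg_generator] at hu
  obtain ⟨cs, hcs, hs'⟩ := exists_antilipschitz_bound (decaySpace H μ) (fst ℝ X X)
    (fun v hv h => eq_zero_of_mem_stable hB hμ hv h)
  obtain ⟨cu, hcu, hu'⟩ := exists_antilipschitz_bound (decaySpace (-H) μ) (fst ℝ X X)
    (fun v hv h => eq_zero_of_mem_unstable hB hμ hv h)
  set M := max Ks Ku with hM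
  have hM0 : 0 ≤ M := hKs.trans (le_max_left _ _)
  set c := min cs cu with hc
  have hc0 : 0 < c := lt_min hcs hcu
  -- Beyond T₂ each part's trace at the opposite endpoint costs at most half the lower bound c, so
  -- it can be absorbed.
  obtain ⟨T₂, hT₂⟩ : ∃ T₂ : ℝ, ∀ T, T₂ ≤ T → M * Real.exp (-μ * T) ≤ c / 2 := by
    have : Tendsto (fun t : ℝ => M * Real.exp (-μ * t)) atTop (𝓝 (M * 0)) :=
      (Real.tendsto_exp_atBot.comp
        (tendsto_id.const_mul_atTop_of_neg (neg_lt_zero.2 hμ))).const_mul M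
    rw [mul_zero] at this
    exact eventually_atTop.1 (this.eventually_le_const (half_pos hc0))
  obtain ⟨d, hd, hlow⟩ := exists_boundaryMap_lower_bound (A := A) (B := B) (C := C) hB
    (T₂ := T₂) hT₁
  obtain ⟨N, hN⟩ := (isCompact_Icc (a := (0 : ℝ)) (b := T₂)).exists_bound_of_continuousOn
    (continuous_linFlow H).continuousOn
  -- K₁ serves T ≥ T₂. K₂ serves T ≤ T₂, where e^{μT₂} compensates for e^{-μt} ≥ e^{-μT₂}.
  set K₁ := 4 * M / c with hK₁
  set K₂ := |N| / d * Real.exp (μ * T₂) with hK₂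
  have hK₁0 : 0 ≤ K₁ := by positivity
  have hK₂0 : 0 ≤ K₂ := by positivity
  refine ⟨K₁ + K₂, by positivity, fun T hT w t ht => ?_⟩
  set g := Real.exp (-μ * t) + Real.exp (-μ * (T - t)) with hg
  have hg0 : 0 ≤ g := by positivity
  have hbn : 0 ≤ ‖boundaryMap A B C T w‖ := norm_nonneg _
  rcases le_total T T₂ with hTT | hTT
  · have h1 : ‖linFlow H t w‖ ≤ |N| * ‖w‖ :=
      (linFlow H t).le_of_opNorm_le ((hN t ⟨ht.1, ht.2.trans hTT⟩).trans (le_abs_self N)) w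
    have h2 := hlow T ⟨hT, hTT⟩ w
    have h3 : ‖w‖ ≤ ‖boundaryMap A B C T w‖ / d := by rwa [le_div_iff₀ hd, mul_comm]
    have h4 : 1 ≤ Real.exp (μ * T₂) * g := by
      have : 1 ≤ Real.exp (μ * T₂) * Real.exp (-μ * t) := by
        rw [← Real.exp_add]
        exact Real.one_le_exp (by nlinarith [ht.2])
      have h5 : 0 ≤ Real.exp (μ * T₂) * Real.exp (-μ * (T - t)) := by positivity
      rw [hg, mul_add]; linarith
    calc ‖linFlow H t w‖ ≤ |N| * (‖boundaryMap A B C T w‖ / d) :=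
          h1.trans (mul_le_mul_of_nonneg_left h3 (abs_nonneg N))
      _ ≤ |N| * (‖boundaryMap A B C T w‖ / d) * (Real.exp (μ * T₂) * g) :=
          le_mul_of_one_le_right (by positivity) h4
      _ = K₂ * ‖boundaryMap A B C T w‖ * g := by rw [hK₂]; ring
      _ ≤ (K₁ + K₂) * ‖boundaryMap A B C T w‖ * g := by gcongr; linarith
  · obtain ⟨ξ, hξ, ζ, hζ, rfl⟩ := Submodule.mem_sup.1
      (show w ∈ decaySpace H μ ⊔ decaySpace (-H) μ by rw [hsup]; trivial)
    -- The growing part is measured by its value at time T, from which it decays backwards.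
    set η := linFlow H T ζ with hη
    have hηm : η ∈ decaySpace (-H) μ := by
      have := linFlow_mem_decaySpace hζ (-T)
      rwa [linFlow_neg_generator, neg_neg] at this
    have hback : ∀ s, linFlow H s ζ = linFlow H (-(T - s)) η := by
      intro s
      rw [hη, ← linFlow_add]; congr 2; ring
    have hsξ : ∀ s, 0 ≤ s → ‖linFlow H s ξ‖ ≤ M * Real.exp (-μ * s) * ‖ξ‖ := fun s h0 =>
      (hs ξ hξ s h0).trans (by gcongr; exact le_max_left _ _)
    have huη : ∀ s, s ≤ T → ‖linFlow H s ζ‖ ≤ M * Real.exp (-μ * (T - s)) * ‖η‖ := fun s h0 => by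
      rw [hback]
      exact (hu η hηm (T - s) (by linarith)).trans (by gcongr; exact le_max_right _ _)
    have hT0 : 0 ≤ T := ht.1.trans ht.2
    have hsmall := hT₂ T hTT
    have b1 : c * ‖ξ‖ - c / 2 * ‖η‖ ≤ ‖boundaryMap A B C T (ξ + ζ)‖ := by
      have e1 : c * ‖ξ‖ ≤ ‖ξ.1‖ :=
        (mul_le_mul_of_nonneg_right (min_le_left _ _) (norm_nonneg _)).trans (hs' ξ hξ)
      have e2 : ‖ζ.1‖ ≤ c / 2 * ‖η‖ := by
        have := huη 0 hT0
        rw [linFlow_zero, sub_zero] at this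
        exact (_root_.norm_fst_le ζ).trans (this.trans (mul_le_mul_of_nonneg_right hsmall (norm_nonneg _)))
      have e3 : ‖ξ.1‖ - ‖ζ.1‖ ≤ ‖ξ.1 + ζ.1‖ := norm_sub_le_norm_add _ _
      have e4 : ‖ξ.1 + ζ.1‖ ≤ ‖boundaryMap A B C T (ξ + ζ)‖ := _root_.norm_fst_le (boundaryMap A B C T (ξ + ζ))
      linarith
    have b2 : c * ‖η‖ - c / 2 * ‖ξ‖ ≤ ‖boundaryMap A B C T (ξ + ζ)‖ := by
      have e1 : c * ‖η‖ ≤ ‖η.1‖ :=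
        (mul_le_mul_of_nonneg_right (min_le_right _ _) (norm_nonneg _)).trans (hu' η hηm)
      have e2 : ‖(linFlow H T ξ).1‖ ≤ c / 2 * ‖ξ‖ :=
        (_root_.norm_fst_le _).trans ((hsξ T hT0).trans
          (mul_le_mul_of_nonneg_right hsmall (norm_nonneg _)))
      have e3 : ‖η.1‖ - ‖(linFlow H T ξ).1‖ ≤ ‖η.1 + (linFlow H T ξ).1‖ := norm_sub_le_norm_add _ _
      have e4 : ‖(linFlow H T (ξ + ζ)).1‖ ≤ ‖boundaryMap A B C T (ξ + ζ)‖ :=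
        _root_.norm_snd_le (boundaryMap A B C T (ξ + ζ))
      rw [map_add, Prod.fst_add, add_comm] at e4
      linarith
    have b3 : ‖ξ‖ + ‖η‖ ≤ 4 / c * ‖boundaryMap A B C T (ξ + ζ)‖ := by
      rw [div_mul_eq_mul_div, le_div_iff₀ hc0]; linarith
    have hξ' : ‖ξ‖ ≤ ‖ξ‖ + ‖η‖ := le_add_of_nonneg_right (norm_nonneg _)
    have hη' : ‖η‖ ≤ ‖ξ‖ + ‖η‖ := le_add_of_nonneg_left (norm_nonneg _)
    calc ‖linFlow H t (ξ + ζ)‖ ≤ ‖linFlow H t ξ‖ + ‖linFlow H t ζ‖ := by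
          rw [map_add]; exact norm_add_le _ _
      _ ≤ M * Real.exp (-μ * t) * (‖ξ‖ + ‖η‖) + M * Real.exp (-μ * (T - t)) * (‖ξ‖ + ‖η‖) :=
          add_le_add ((hsξ t ht.1).trans (by gcongr)) ((huη t ht.2).trans (by gcongr))
      _ = M * g * (‖ξ‖ + ‖η‖) := by rw [hg]; ring
      _ ≤ M * g * (4 / c * ‖boundaryMap A B C T (ξ + ζ)‖) := by gcongr
      _ = K₁ * ‖boundaryMap A B C T (ξ + ζ)‖ * g := by rw [hK₁]; ring
      _ ≤ (K₁ + K₂) * ‖boundaryMap A B C T (ξ + ζ)‖ * g := by gcongr; linarith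

end Hamiltonian

/-! ### Weak trajectories, optimality and the steady problem. -/

section Trajectories

open ContinuousLinearMap

open scoped InnerProductSpace

/-- Since h is merely integrable, its primitive is only absolutely continuous, and the product rule
holds almost everywhere. -/
theorem integral_deriv_mul_add_mul {T c : ℝ} {f f' h : ℝ → ℝ} (hf : ∀ t, HasDerivAt f (f' t) t)
    (hf' : Continuous f') (hh : IntervalIntegrable h volume 0 T) :
    ∫ t in (0 : ℝ)..T, (f' t * (c + ∫ s in (0 : ℝ)..t, h s) + f t * h t) =
      f T * (c + ∫ s in (0 : ℝ)..T, h s) - f 0 * c := by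
  have hfac : AbsolutelyContinuousOnInterval f 0 T := by
    have h1 : f = fun t => f 0 + ∫ s in (0 : ℝ)..t, f' s := by
      funext t
      rw [intervalIntegral.integral_eq_sub_of_hasDerivAt (fun s _ => hf s)
        (hf'.intervalIntegrable _ _)]
      ring
    rw [h1]
    exact (LipschitzWith.const (f 0)).lipschitzOnWith.absolutelyContinuousOnInterval.add
      ((hf'.intervalIntegrable 0 T).absolutelyContinuousOnInterval_intervalIntegral (by simp))
  have hgac : AbsolutelyContinuousOnInterval (fun t => c + ∫ s in (0 : ℝ)..t, h s) 0 T :=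
    (LipschitzWith.const c).lipschitzOnWith.absolutelyContinuousOnInterval.add
      (hh.absolutelyContinuousOnInterval_intervalIntegral (by simp))
  have h2 := hfac.integral_deriv_mul_eq_sub hgac
  rw [intervalIntegral.integral_same, add_zero] at h2
  rw [← h2]
  refine intervalIntegral.integral_congr_ae ?_
  filter_upwards [hh.ae_hasDerivAt_integral] with t ht htm
  rw [(hf t).deriv, ((ht (uIoc_subset_uIcc htm) 0 (by simp)).const_add c).deriv]

/-- Integration by parts for the pairing of a `C¹` function with the primitive of an integrable
one. -/
theorem integral_inner_add_inner {k : ℕ} {T : ℝ} (hT : 0 ≤ T) {p p' x g : ℝ → Vec k} {c : Vec k}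
    (hp : ∀ t, HasDerivAt p (p' t) t) (hp' : Continuous p')
    (hg : IntervalIntegrable g volume 0 T)
    (hx : ∀ t ∈ Icc 0 T, x t = c + ∫ s in (0 : ℝ)..t, g s) :
    ∫ t in (0 : ℝ)..T, (⟪p' t, x t⟫_ℝ + ⟪p t, g t⟫_ℝ) = ⟪p T, x T⟫_ℝ - ⟪p 0, x 0⟫_ℝ := by
  have hpc : Continuous p := continuous_iff_continuousAt.2 fun t => (hp t).continuousAt
  have hcoord : ∀ i, IntervalIntegrable (fun t => g t i) volume 0 T := fun i =>
    ⟨(EuclideanSpace.proj (𝕜 := ℝ) i).integrable_comp hg.1,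
      (EuclideanSpace.proj (𝕜 := ℝ) i).integrable_comp hg.2⟩
  have hsub : ∀ t ∈ Icc 0 T, IntervalIntegrable g volume 0 t := fun t ht =>
    hg.mono_set (by rw [uIcc_of_le ht.1, uIcc_of_le hT]; exact Icc_subset_Icc_right ht.2)
  have hxi : ∀ i, ∀ t ∈ Icc 0 T, x t i = c i + ∫ s in (0 : ℝ)..t, g s i := by
    intro i t ht
    have := (EuclideanSpace.proj (𝕜 := ℝ) i).intervalIntegral_comp_comm (hsub t ht)
    rw [hx t ht]
    simpa using this.symm
  have hinner : ∀ a b : Vec k, ⟪a, b⟫_ℝ = ∑ i, a i * b i := fun a b => by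
    simp [PiLp.inner_apply, mul_comm]
  have h0 : (0 : ℝ) ∈ Icc 0 T := left_mem_Icc.2 hT
  have hTm : T ∈ Icc 0 T := right_mem_Icc.2 hT
  have hprim : ∀ i, ContinuousOn (fun t => c i + ∫ s in (0 : ℝ)..t, g s i) (uIcc 0 T) := fun i =>
    continuousOn_const.add
      (intervalIntegral.continuousOn_primitive_interval' (hcoord i) (by simp))
  calc ∫ t in (0 : ℝ)..T, (⟪p' t, x t⟫_ℝ + ⟪p t, g t⟫_ℝ)
      = ∫ t in (0 : ℝ)..T, ∑ i, (p' t i * (c i + ∫ s in (0 : ℝ)..t, g s i) + p t i * g t i) := by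
        refine intervalIntegral.integral_congr fun t ht => ?_
        rw [uIcc_of_le hT] at ht
        simp only [hinner, Finset.sum_add_distrib]
        congr 1
        exact Finset.sum_congr rfl fun i _ => by rw [hxi i t ht]
    _ = ∑ i, ∫ t in (0 : ℝ)..T, (p' t i * (c i + ∫ s in (0 : ℝ)..t, g s i) + p t i * g t i) := by
        refine intervalIntegral.integral_finsetSum fun i _ => ?_
        refine IntervalIntegrable.add ?_ ?_
        · exact (ContinuousOn.mul (by fun_prop) (hprim i)).intervalIntegrable
        · exact (hcoord i).continuousOn_mul (by fun_prop)
    _ = ∑ i, (p T i * x T i - p 0 i * x 0 i) := by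
        refine Finset.sum_congr rfl fun i _ => ?_
        have hpi : ∀ t, HasDerivAt (fun t => p t i) (p' t i) t := fun t =>
          (EuclideanSpace.proj (𝕜 := ℝ) i).hasFDerivAt.comp_hasDerivAt t (hp t)
        rw [integral_deriv_mul_add_mul hpi (by fun_prop) (hcoord i), hxi i T hTm, hxi i 0 h0,
          intervalIntegral.integral_same, add_zero]
    _ = ⟪p T, x T⟫_ℝ - ⟪p 0, x 0⟫_ℝ := by rw [hinner, hinner, Finset.sum_sub_distrib]

/-- Multiplication by a matrix as a continuous linear map between Euclidean spaces. -/
def mulVL {k l : ℕ} (M : Matrix (Fin k) (Fin l) ℝ) : Vec l →L[ℝ] Vec k :=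
  LinearMap.toContinuousLinearMap
    { toFun := mulV M
      map_add' := fun v w => by ext i; simp [Matrix.mulVec_add]
      map_smul' := fun c v => by ext i; simp [Matrix.mulVec_smul] }

theorem mulVL_apply {k l : ℕ} (M : Matrix (Fin k) (Fin l) ℝ) (v : Vec l) :
    mulVL M v = mulV M v := rfl

variable {n m : ℕ} {A C : Matrix (Fin n) (Fin n) ℝ} {B : Matrix (Fin n) (Fin m) ℝ}
  {T : ℝ} {x₀ x₁ z : Vec n} {u v : ℝ → Vec m} {x y : ℝ → Vec n}

theorem memLp_of_continuousOn_Icc {k : ℕ} {f : ℝ → Vec k} (hf : ContinuousOn f (Icc 0 T)) :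
    MemLp f 2 (volume.restrict (Ioc 0 T)) := by
  obtain ⟨K, hK⟩ := isCompact_Icc.exists_bound_of_continuousOn hf
  refine MemLp.of_bound
    ((hf.mono Ioc_subset_Icc_self).aestronglyMeasurable measurableSet_Ioc) K ?_
  filter_upwards [ae_restrict_mem measurableSet_Ioc] with t ht
  exact hK t (Ioc_subset_Icc_self ht)

theorem intervalIntegrable_norm_sq {k : ℕ} {f : ℝ → Vec k} (hT : 0 ≤ T)
    (hf : MemLp f 2 (volume.restrict (Ioc 0 T))) :
    IntervalIntegrable (fun t => ‖f t‖ ^ 2) volume 0 T :=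
  (intervalIntegrable_iff_integrableOn_Ioc_of_le hT).2 hf.norm.integrable_sq

namespace IsTrajectory

theorem memLp_control (h : IsTrajectory A B T x₀ x₁ u x) :
    MemLp u 2 (volume.restrict (Ioc 0 T)) := by
  rw [← Measure.restrict_congr_set (Ioo_ae_eq_Ioc (a := (0 : ℝ)) (b := T))]
  exact h.control_memLp

theorem memLp_state (h : IsTrajectory A B T x₀ x₁ u x) :
    MemLp x 2 (volume.restrict (Ioc 0 T)) := memLp_of_continuousOn_Icc h.state_continuous

theorem intervalIntegrable (hT : 0 ≤ T) (h : IsTrajectory A B T x₀ x₁ u x) :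
    IntervalIntegrable (fun t => mulVL A (x t) + mulVL B (u t)) volume 0 T :=
  (intervalIntegrable_iff_integrableOn_Ioc_of_le hT).2
    (((mulVL A).comp_memLp' h.memLp_state).add
      ((mulVL B).comp_memLp' h.memLp_control) |>.integrable one_le_two)

theorem initial_eq (hT : 0 ≤ T) (h : IsTrajectory A B T x₀ x₁ u x) : x 0 = x₀ := by
  simpa using h.state_eq 0 (left_mem_Icc.2 hT)

theorem integral_inner (hT : 0 ≤ T) (h : IsTrajectory A B T x₀ x₁ u x) {p p' : ℝ → Vec n}
    (hp : ∀ t, HasDerivAt p (p' t) t) (hp' : Continuous p') :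
    ∫ t in (0 : ℝ)..T, (⟪p' t, x t⟫_ℝ + ⟪p t, mulVL A (x t) + mulVL B (u t)⟫_ℝ) =
      ⟪p T, x₁⟫_ℝ - ⟪p 0, x₀⟫_ℝ := by
  rw [integral_inner_add_inner hT hp hp' (h.intervalIntegrable hT) h.state_eq, h.final_eq,
    h.initial_eq hT]

theorem sub {y₀ y₁ : Vec n} (hT : 0 ≤ T) (h : IsTrajectory A B T x₀ x₁ u x)
    (h' : IsTrajectory A B T y₀ y₁ v y) :
    IsTrajectory A B T (y₀ - x₀) (y₁ - x₁) (v - u) (y - x) where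
  control_memLp := h'.control_memLp.sub h.control_memLp
  state_continuous := h'.state_continuous.sub h.state_continuous
  state_eq t ht := by
    have hsub : ∀ {g : ℝ → Vec n}, IntervalIntegrable g volume 0 T →
        IntervalIntegrable g volume 0 t := fun hg =>
      hg.mono_set (by rw [uIcc_of_le ht.1, uIcc_of_le hT]; exact Icc_subset_Icc_right ht.2)
    have e := intervalIntegral.integral_sub (hsub (h'.intervalIntegrable hT))
      (hsub (h.intervalIntegrable hT))
    have e' : ∀ s, mulV A ((y - x) s) + mulV B ((v - u) s) =
        (mulVL A (y s) + mulVL B (v s)) - (mulVL A (x s) + mulVL B (u s)) := fun s => by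
      rw [← mulVL_apply, ← mulVL_apply, Pi.sub_apply, Pi.sub_apply, map_sub, map_sub]
      abel
    simp only [e']
    rw [e, Pi.sub_apply, h'.state_eq t ht, h.state_eq t ht]
    simp only [mulVL_apply]
    abel
  final_eq := by rw [Pi.sub_apply, h'.final_eq, h.final_eq]

/-- A trajectory from the origin with almost everywhere vanishing control vanishes. -/
theorem eq_zero_of_control_ae_eq_zero (h : IsTrajectory A B T 0 x₁ u x)
    (hu : ∀ᵐ t ∂(volume.restrict (Ioc 0 T)), u t = 0) {t : ℝ} (ht : t ∈ Icc 0 T) : x t = 0 := by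
  set D := adjoint (mulVL A) with hD
  -- Adjoint solution equal to x(t) at time t: its pairing with x is conserved and starts at 0, so
  -- ‖x(t)‖² = 0.
  let p : ℝ → Vec n := fun s => linFlow (-D) (s - t) (x t)
  have hp : ∀ s, HasDerivAt p (-(D (p s))) s := fun s =>
    (hasDerivAt_linFlow (-D) (x t) (s - t)).comp_sub_const s t
  have hpc : Continuous p := continuous_iff_continuousAt.2 fun s => (hp s).continuousAt
  have hrestr : IsTrajectory A B t 0 (x t) u x :=
    { control_memLp := h.control_memLp.mono_measure
        (Measure.restrict_mono (Ioo_subset_Ioo_right ht.2) le_rfl)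
      state_continuous := h.state_continuous.mono (Icc_subset_Icc_right ht.2)
      state_eq := fun s hs => h.state_eq s ⟨hs.1, hs.2.trans ht.2⟩
      final_eq := rfl }
  have e := hrestr.integral_inner ht.1 hp (by fun_prop)
  have e0 : ∫ s in (0 : ℝ)..t, (⟪-(D (p s)), x s⟫_ℝ +
      ⟪p s, mulVL A (x s) + mulVL B (u s)⟫_ℝ) = 0 := by
    refine intervalIntegral.integral_zero_ae ?_
    rw [ae_restrict_iff' measurableSet_Ioc] at hu
    filter_upwards [hu] with s hs hst
    rw [uIoc_of_le ht.1] at hst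
    rw [hs ⟨hst.1, hst.2.trans ht.2⟩, map_zero, add_zero, inner_neg_left, hD, adjoint_inner_left,
      neg_add_cancel]
  rw [e0, inner_zero_right, sub_zero] at e
  have : p t = x t := by simp [p, linFlow_zero]
  rw [this] at e
  exact inner_self_eq_zero.1 e.symm

end IsTrajectory

/-- Steer q(0) to 0. If B†q = 0, the pairing ⟪q, x⟫ is conserved, so ‖q(0)‖² = 0. -/
theorem IsControllable.adjointObservable (h : IsControllable A B) :
    AdjointObservable (mulVL A) (mulVL B) := by
  intro q hq hBq
  obtain ⟨T, hT, u, x, hx⟩ := h (q 0) 0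
  have hqc : Continuous q := continuous_iff_continuousAt.2 fun s => (hq s).continuousAt
  have e := hx.integral_inner hT.le hq (by fun_prop)
  have e0 : ∀ t, ⟪-(adjoint (mulVL A) (q t)), x t⟫_ℝ +
      ⟪q t, mulVL A (x t) + mulVL B (u t)⟫_ℝ = 0 := fun t => by
    rw [inner_add_right, inner_neg_left, adjoint_inner_left, ← adjoint_inner_left (mulVL B), hBq,
      inner_zero_left]
    ring
  simp only [e0, intervalIntegral.integral_zero, inner_zero_right, zero_sub] at e
  exact inner_self_eq_zero.1 (neg_eq_zero.1 e.symm)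

/-- A nonzero x + iy would be an eigenvector for iβ in the kernel of the stacked matrix,
contradicting full column rank. -/
theorem WeakHautusTest.imaginaryObservable (h : WeakHautusTest A C) :
    ImaginaryObservable (mulVL A) (mulVL C) := by
  intro β x y hx hy hCx hCy
  let w : Fin n → ℂ := fun i => (x i : ℂ) + y i * Complex.I
  have hmul : ∀ M : Matrix (Fin n) (Fin n) ℝ, ∀ i, ((M.map Complex.ofReal).mulVec w) i =
      (mulVL M x i : ℂ) + mulVL M y i * Complex.I := by
    intro M i
    simp only [Matrix.mulVec, dotProduct, w, mulVL_apply, Matrix.map_apply, Complex.ofReal_sum,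
      Complex.ofReal_mul, Finset.sum_mul, ← Finset.sum_add_distrib]
    exact Finset.sum_congr rfl fun j _ => by ring
  have hA : (A.map Complex.ofReal).mulVec w = ((β : ℂ) * Complex.I) • w := by
    ext i
    rw [hmul, hx, hy]
    simp only [w, PiLp.smul_apply, Pi.smul_apply, smul_eq_mul, Complex.ofReal_mul,
      Complex.ofReal_neg]
    linear_combination (-(β : ℂ) * y i) * Complex.I_sq
  have hC : (C.map Complex.ofReal).mulVec w = 0 := by
    ext i
    rw [hmul, hCx, hCy]
    simp
  have hw : w = 0 := by
    by_contra hw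
    have hspec : (β : ℂ) * Complex.I ∈ spectrum ℂ (A.map Complex.ofReal) := by
      rw [← Matrix.spectrum_toLin']
      exact (Module.End.hasEigenvalue_of_hasEigenvector
        ⟨Module.End.mem_eigenspace_iff.2 (by simpa using hA), hw⟩).mem_spectrum
    have hrank := h β hspec
    set N := Matrix.fromRows
      (A.map Complex.ofReal - ((β : ℂ) * Complex.I) • (1 : Matrix (Fin n) (Fin n) ℂ))
      (C.map Complex.ofReal) with hN
    have hker : N.mulVecLin w = 0 := by
      rw [Matrix.mulVecLin_apply, hN, Matrix.fromRows_mulVec, Matrix.sub_mulVec,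
        Matrix.smul_mulVec, Matrix.one_mulVec, hA, hC]
      ext i
      rcases i with i | i <;> simp
    have hdim := N.mulVecLin.finrank_range_add_finrank_ker
    have hr : Module.finrank ℂ (LinearMap.range N.mulVecLin) = n := hrank
    rw [hr, Module.finrank_fin_fun, Nat.add_eq_left, Submodule.finrank_eq_zero] at hdim
    have : w ∈ LinearMap.ker N.mulVecLin := hker
    rw [hdim] at this
    exact hw ((Submodule.mem_bot ℂ).1 this)
  have hwi : ∀ i, x i = 0 ∧ y i = 0 := fun i => by
    have h0 : (x i : ℂ) + y i * Complex.I = 0 := congrFun hw i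
    have h1 := congrArg Complex.re h0
    have h2 := congrArg Complex.im h0
    simp at h1 h2
    exact ⟨h1, h2⟩
  exact ⟨by ext i; exact (hwi i).1, by ext i; exact (hwi i).2⟩

/-- Pointwise completion of squares in the tracking cost. -/
theorem tracking_cost_eq {X U Z : Type*} [NormedAddCommGroup X] [NormedAddCommGroup U]
    [NormedAddCommGroup Z] [InnerProductSpace ℝ X] [InnerProductSpace ℝ U] [InnerProductSpace ℝ Z]
    [CompleteSpace X] [CompleteSpace U] [CompleteSpace Z] (A : X →L[ℝ] X) (B : U →L[ℝ] X)
    (C : X →L[ℝ] Z) (z : Z) (p x y : X) (v : U) :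
    ‖v‖ ^ 2 + ‖C y - z‖ ^ 2 =
      ‖-(adjoint B p)‖ ^ 2 + ‖C x - z‖ ^ 2 +
        (‖v - -(adjoint B p)‖ ^ 2 + ‖C (y - x)‖ ^ 2) -
        2 * (⟪-(adjoint A p) - adjoint C (C x - z), y - x⟫_ℝ +
          ⟪p, A (y - x) + B (v - -(adjoint B p))⟫_ℝ) := by
  set u := -(adjoint B p) with hu
  have e1 : ‖v‖ ^ 2 = ‖u‖ ^ 2 + 2 * ⟪u, v - u⟫_ℝ + ‖v - u‖ ^ 2 := by
    rw [← norm_add_sq_real, add_sub_cancel]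
  have e2 : ‖C y - z‖ ^ 2 =
      ‖C x - z‖ ^ 2 + 2 * ⟪C x - z, C (y - x)⟫_ℝ + ‖C (y - x)‖ ^ 2 := by
    rw [← norm_add_sq_real, map_sub]; congr 2; abel
  have e3 : ⟪p, B (v - u)⟫_ℝ = -⟪u, v - u⟫_ℝ := by
    rw [hu, inner_neg_left, neg_neg, adjoint_inner_left]
  have e4 : ⟪-(adjoint A p) - adjoint C (C x - z), y - x⟫_ℝ =
      -⟪p, A (y - x)⟫_ℝ - ⟪C x - z, C (y - x)⟫_ℝ := by
    rw [inner_sub_left, inner_neg_left, adjoint_inner_left, adjoint_inner_left]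
  rw [e1, e2, e4, inner_add_right, e3]
  ring

/-- A trajectory driven by a costate through `u = -B† p` is optimal, with a quadratic gap. -/
theorem cost_eq_add_of_costate (hT : 0 ≤ T) {p : ℝ → Vec n} (hx : Continuous x)
    (hp : ∀ t, HasDerivAt p
      (-(adjoint (mulVL A) (p t)) - adjoint (mulVL C) (mulVL C (x t) - z)) t)
    (hxt : IsTrajectory A B T x₀ x₁ (fun t => -(adjoint (mulVL B) (p t))) x)
    (hyt : IsTrajectory A B T x₀ x₁ v y) :
    cost C z T v y = cost C z T (fun t => -(adjoint (mulVL B) (p t))) x +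
      (1 / 2) * ∫ t in (0 : ℝ)..T,
        (‖v t - -(adjoint (mulVL B) (p t))‖ ^ 2 + ‖mulVL C (y t - x t)‖ ^ 2) := by
  set u : ℝ → Vec m := fun t => -(adjoint (mulVL B) (p t)) with hu
  have hpc : Continuous p := continuous_iff_continuousAt.2 fun s => (hp s).continuousAt
  have hint : ∀ {w : ℝ → Vec m} {s : ℝ → Vec n}, IsTrajectory A B T x₀ x₁ w s →
      IntervalIntegrable (fun t => ‖w t‖ ^ 2 + ‖mulVL C (s t) - z‖ ^ 2) volume 0 T := fun hw =>
    (intervalIntegrable_norm_sq hT hw.memLp_control).add (intervalIntegrable_norm_sq hT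
      (((mulVL C).comp_memLp' hw.memLp_state).sub (memLp_const z)))
  have hgap : IntervalIntegrable (fun t => ‖v t - u t‖ ^ 2 + ‖mulVL C (y t - x t)‖ ^ 2)
      volume 0 T :=
    (intervalIntegrable_norm_sq hT (hyt.memLp_control.sub hxt.memLp_control)).add
      (intervalIntegrable_norm_sq hT
        ((mulVL C).comp_memLp' (hyt.memLp_state.sub hxt.memLp_state)))
  -- The difference of two admissible states vanishes at both ends, so the first-order term
  -- integrates to zero.
  have hzero := (hxt.sub hT hyt).integral_inner hT hp (by fun_prop)
  rw [sub_self, sub_self, inner_zero_right, inner_zero_right, sub_zero] at hzero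
  have hpt := fun t => tracking_cost_eq (mulVL A) (mulVL B) (mulVL C) z (p t) (x t) (y t) (v t)
  have hsub := intervalIntegral.integral_sub ((hint hyt).sub (hint hxt)) hgap
  rw [intervalIntegral.integral_sub (hint hyt) (hint hxt)] at hsub
  have hlhs : ∫ t in (0 : ℝ)..T, ((‖v t‖ ^ 2 + ‖mulVL C (y t) - z‖ ^ 2) -
      (‖u t‖ ^ 2 + ‖mulVL C (x t) - z‖ ^ 2) -
      (‖v t - u t‖ ^ 2 + ‖mulVL C (y t - x t)‖ ^ 2)) = 0 := by
    have : ∀ t, (‖v t‖ ^ 2 + ‖mulVL C (y t) - z‖ ^ 2) -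
        (‖u t‖ ^ 2 + ‖mulVL C (x t) - z‖ ^ 2) -
        (‖v t - u t‖ ^ 2 + ‖mulVL C (y t - x t)‖ ^ 2) =
        -2 * (⟪-(adjoint (mulVL A) (p t)) - adjoint (mulVL C) (mulVL C (x t) - z), (y - x) t⟫_ℝ +
          ⟪p t, mulVL A ((y - x) t) + mulVL B ((v - u) t)⟫_ℝ) := fun t => by
      rw [hpt t]
      simp only [hu, Pi.sub_apply]
      ring
    simp only [this]
    rw [intervalIntegral.integral_const_mul, hzero, mul_zero]
  rw [hlhs] at hsub
  simp only [cost, ← mulVL_apply]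
  linarith

/-- A trajectory driven by a costate is the unique optimal pair. -/
theorem isOptimalPair_of_costate (hT : 0 ≤ T) {p : ℝ → Vec n} (hx : Continuous x)
    (hp : ∀ t, HasDerivAt p
      (-(adjoint (mulVL A) (p t)) - adjoint (mulVL C) (mulVL C (x t) - z)) t)
    (hxt : IsTrajectory A B T x₀ x₁ (fun t => -(adjoint (mulVL B) (p t))) x) :
    IsOptimalPair A B C z x₀ x₁ T (fun t => -(adjoint (mulVL B) (p t))) x ∧
      ∀ v y, IsOptimalPair A B C z x₀ x₁ T v y →
        (∀ᵐ t ∂(volume.restrict (Ioo 0 T)), v t = -(adjoint (mulVL B) (p t))) ∧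
          EqOn y x (Icc 0 T) := by
  refine ⟨⟨hxt, fun v y hyt => ?_⟩, fun v y hy => ?_⟩
  · rw [cost_eq_add_of_costate hT hx hp hxt hyt]
    have := intervalIntegral.integral_nonneg (μ := volume) hT (fun t _ => show
      0 ≤ ‖v t - -(adjoint (mulVL B) (p t))‖ ^ 2 + ‖mulVL C (y t - x t)‖ ^ 2 by positivity)
    linarith
  · have hyt := hy.1
    have h1 := hy.2 _ _ hxt
    rw [cost_eq_add_of_costate hT hx hp hxt hyt] at h1
    have hnn : ∀ t, 0 ≤ ‖v t - -(adjoint (mulVL B) (p t))‖ ^ 2 + ‖mulVL C (y t - x t)‖ ^ 2 :=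
      fun t => by positivity
    have h2 := intervalIntegral.integral_nonneg (μ := volume) hT (fun t _ => hnn t)
    have h3 := le_antisymm (by linarith) h2
    rw [intervalIntegral.integral_eq_zero_iff_of_le_of_nonneg_ae hT
      (Filter.Eventually.of_forall hnn) ((intervalIntegrable_norm_sq hT
        (hyt.memLp_control.sub hxt.memLp_control)).add (intervalIntegrable_norm_sq hT
          ((mulVL C).comp_memLp' (hyt.memLp_state.sub hxt.memLp_state))))] at h3
    have h4 : ∀ᵐ t ∂(volume.restrict (Ioc 0 T)), v t = -(adjoint (mulVL B) (p t)) := by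
      filter_upwards [h3] with t ht
      have n1 := sq_nonneg ‖v t - -(adjoint (mulVL B) (p t))‖
      have n2 := sq_nonneg ‖mulVL C (y t - x t)‖
      rw [Pi.zero_apply] at ht
      have : ‖v t - -(adjoint (mulVL B) (p t))‖ ^ 2 = 0 := by linarith
      exact sub_eq_zero.1 (by simpa using this)
    refine ⟨ae_restrict_of_ae_restrict_of_subset Ioo_subset_Ioc_self h4, fun t ht => ?_⟩
    have hd := hxt.sub hT hyt
    rw [sub_self] at hd
    refine sub_eq_zero.1 (hd.eq_zero_of_control_ae_eq_zero ?_ ht)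
    filter_upwards [h4] with s hs
    exact sub_eq_zero.2 hs

/-- Steady states with a multiplier are the unique steady optima. -/
theorem steady_optimal_iff_of_costate (hC : ImaginaryObservable (mulVL A) (mulVL C))
    {p xb : Vec n} (h1 : mulVL A xb + mulVL B (-(adjoint (mulVL B) p)) = 0)
    (h2 : -(adjoint (mulVL A) p) - adjoint (mulVL C) (mulVL C xb - z) = 0) (v : Vec m)
    (y : Vec n) : IsSteadyOptimal A B C z v y ↔ v = -(adjoint (mulVL B) p) ∧ y = xb := by
  have key : ∀ (v : Vec m) (y : Vec n), 0 = mulV A y + mulV B v → steadyCost C z v y =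
      steadyCost C z (-(adjoint (mulVL B) p)) xb +
        (1 / 2) * (‖v - -(adjoint (mulVL B) p)‖ ^ 2 + ‖mulVL C (y - xb)‖ ^ 2) := by
    intro v y h
    have e := tracking_cost_eq (mulVL A) (mulVL B) (mulVL C) z p xb y v
    have e0 : mulVL A (y - xb) + mulVL B (v - -(adjoint (mulVL B) p)) = 0 := by
      rw [map_sub, map_sub, sub_add_sub_comm, h1, mulVL_apply, mulVL_apply, ← h, sub_zero]
    rw [e0, h2, inner_zero_left, inner_zero_right] at e
    simp only [steadyCost, ← mulVL_apply]
    linarith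
  have hopt : IsSteadyOptimal A B C z (-(adjoint (mulVL B) p)) xb := by
    refine ⟨h1.symm, fun v y h => ?_⟩
    rw [key v y h]
    have : 0 ≤ ‖v - -(adjoint (mulVL B) p)‖ ^ 2 + ‖mulVL C (y - xb)‖ ^ 2 := by positivity
    linarith
  constructor
  · rintro ⟨h, hmin⟩
    have := hmin _ _ h1.symm
    rw [key v y h] at this
    have n1 := sq_nonneg ‖v - -(adjoint (mulVL B) p)‖
    have n2 := sq_nonneg ‖mulVL C (y - xb)‖
    have z1 : ‖v - -(adjoint (mulVL B) p)‖ ^ 2 = 0 := by linarith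
    have z2 : ‖mulVL C (y - xb)‖ ^ 2 = 0 := by linarith
    have hv : v = -(adjoint (mulVL B) p) := sub_eq_zero.1 (by simpa using z1)
    have hCy : mulVL C (y - xb) = 0 := by simpa using z2
    have hAy : mulVL A (y - xb) = 0 := by
      rw [map_sub, mulVL_apply A y, eq_neg_of_add_eq_zero_left h1, ← hv, sub_neg_eq_add]
      exact h.symm
    -- The gap controls only Cy; the Hautus test at β = 0 recovers the steady state itself.
    have h0 := hC 0 (y - xb) (y - xb) (by simpa using hAy) (by simpa using hAy) hCy hCy
    exact ⟨hv, sub_eq_zero.1 h0.1⟩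
  · rintro ⟨rfl, rfl⟩
    exact hopt

/-- The steady optimality system is H(x, p) = (0, -C†z), solvable because 0 is not an eigenvalue of
H. -/
theorem exists_steady_costate (hB : AdjointObservable (mulVL A) (mulVL B))
    (hC : ImaginaryObservable (mulVL A) (mulVL C)) (z : Vec n) : ∃ p xb : Vec n,
      mulVL A xb + mulVL B (-(adjoint (mulVL B) p)) = 0 ∧
      -(adjoint (mulVL A) p) - adjoint (mulVL C) (mulVL C xb - z) = 0 := by
  obtain ⟨⟨xb, p⟩, h⟩ := hamiltonian_surjective hB hC (0, -(adjoint (mulVL C) z))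
  rw [hamiltonian_apply, Prod.mk.injEq] at h
  refine ⟨p, xb, ?_, ?_⟩
  · rw [map_neg, ← sub_eq_add_neg]; exact h.1
  · have h2 := h.2
    simp only at h2
    rw [map_sub, sub_sub_eq_add_sub, ← sub_eq_zero.2 h2]
    abel

/-- Adding a steady state to a solution of the homogeneous Hamiltonian system gives a solution of
the optimality system. -/
theorem exists_optimality_trajectory (hB : AdjointObservable (mulVL A) (mulVL B)) (hT : 0 < T)
    {pb xb : Vec n} (h1 : mulVL A xb + mulVL B (-(adjoint (mulVL B) pb)) = 0)
    (h2 : -(adjoint (mulVL A) pb) - adjoint (mulVL C) (mulVL C xb - z) = 0) (x₀ x₁ : Vec n) :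
    ∃ w, boundaryMap (mulVL A) (mulVL B) (mulVL C) T w = (x₀ - xb, x₁ - xb) ∧
      let y := fun t => linFlow (hamiltonian (mulVL A) (mulVL B) (mulVL C)) t w
      (∀ t, HasDerivAt (fun t => pb + (y t).2) (-(adjoint (mulVL A) (pb + (y t).2)) -
        adjoint (mulVL C) (mulVL C (xb + (y t).1) - z)) t) ∧
      IsTrajectory A B T x₀ x₁ (fun t => -(adjoint (mulVL B) (pb + (y t).2)))
        (fun t => xb + (y t).1) := by
  obtain ⟨w, hw⟩ := boundaryMap_surjective (C := mulVL C) hB hT (x₀ - xb, x₁ - xb)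
  refine ⟨w, hw, ?_⟩
  intro y
  have hy : Continuous y :=
    continuous_iff_continuousAt.2 fun t => (hasDerivAt_linFlow _ w t).continuousAt
  rw [boundaryMap_apply, Prod.mk.injEq] at hw
  have hx : ∀ t, HasDerivAt (fun t => xb + (y t).1) (mulVL A (xb + (y t).1) +
      mulVL B (-(adjoint (mulVL B) (pb + (y t).2)))) t := by
    intro t
    refine ((hasDerivAt_hamiltonian_fst w t).const_add xb).congr_deriv ?_
    rw [map_neg] at h1
    simp only [map_add, map_neg]
    rw [eq_neg_of_add_eq_zero_left h1]
    abel
  refine ⟨fun t => ?_, ?_⟩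
  · refine ((hasDerivAt_hamiltonian_snd w t).const_add pb).congr_deriv ?_
    rw [map_sub] at h2
    simp only [map_add, map_sub]
    rw [neg_add, sub_eq_zero.1 h2]
    simp only [y]
    abel
  · refine ⟨?_, by fun_prop, fun t ht => ?_, ?_⟩
    · rw [Measure.restrict_congr_set (Ioo_ae_eq_Ioc (a := (0 : ℝ)) (b := T))]
      exact memLp_of_continuousOn_Icc (by fun_prop)
    · have h := intervalIntegral.integral_eq_sub_of_hasDerivAt (a := 0) (b := t)
        (fun s _ => hx s) (Continuous.intervalIntegrable (by fun_prop) _ _)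
      simp only [mulVL_apply] at h
      rw [h]
      have : xb + (y 0).1 = x₀ := by simp [y, linFlow_zero, hw.1]
      rw [this, add_sub_cancel]
    · rw [hw.2, add_sub_cancel]

end Trajectories

end

/-! ### The turnpike theorem. -/

theorem proposition2p1 (n m : ℕ) (A : Matrix (Fin n) (Fin n) ℝ) (B : Matrix (Fin n) (Fin m) ℝ)
    (C : Matrix (Fin n) (Fin n) ℝ) (hAB : IsControllable A B) (hAC : WeakHautusTest A C) :
    (∀ z : Vec n, ∃! w : Vec m × Vec n, IsSteadyOptimal A B C z w.1 w.2) ∧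
    ∃ μ : ℝ, 0 < μ ∧ ∀ x₀ x₁ z : Vec n, ∃ K : ℝ, 0 < K ∧
      ∀ (ubar : Vec m) (xbar : Vec n), IsSteadyOptimal A B C z ubar xbar →
      ∀ T : ℝ, 2 < T →
        ∃ (uT : ℝ → Vec m) (xT : ℝ → Vec n),
          IsOptimalPair A B C z x₀ x₁ T uT xT ∧
          ContinuousOn uT (Set.Icc 0 T) ∧
          (∀ u x, IsOptimalPair A B C z x₀ x₁ T u x →
            (∀ᵐ t ∂(MeasureTheory.volume.restrict (Set.Ioo 0 T)), u t = uT t) ∧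
            Set.EqOn x xT (Set.Icc 0 T)) ∧
          ∀ t ∈ Set.Icc 0 T,
            ‖uT t - ubar‖ + ‖xT t - xbar‖ ≤
              K * (Real.exp (-μ * t) + Real.exp (-μ * (T - t))) := by
  have hB := hAB.adjointObservable
  have hC := hAC.imaginaryObservable
  refine ⟨fun z => ?_, ?_⟩
  · obtain ⟨p, xb, h1, h2⟩ := exists_steady_costate hB hC z
    refine ⟨(-(ContinuousLinearMap.adjoint (mulVL B) p), xb),
      (steady_optimal_iff_of_costate hC h1 h2 _ _).2 ⟨rfl, rfl⟩, fun w hw => ?_⟩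
    obtain ⟨e1, e2⟩ := (steady_optimal_iff_of_costate hC h1 h2 _ _).1 hw
    exact Prod.ext e1 e2
  obtain ⟨μ, hμ, K, hK, hbound⟩ := exists_turnpike_bound hB hC (two_pos (α := ℝ))
  refine ⟨μ, hμ, fun x₀ x₁ z => ?_⟩
  obtain ⟨pb, xb, h1, h2⟩ := exists_steady_costate hB hC z
  set β := ‖ContinuousLinearMap.adjoint (mulVL B)‖ with hβ
  have hβ0 : 0 ≤ β := norm_nonneg _
  -- The factor β bounds the control deviation B†p and the 1 beside it the state deviation; the
  -- final + 1 only ensures positivity when x₀ = x₁ = xb.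
  refine ⟨(β + 1) * (K * ‖(x₀ - xb, x₁ - xb)‖) + 1, by positivity, ?_⟩
  intro ubar xbar hopt T hT
  obtain ⟨rfl, rfl⟩ := (steady_optimal_iff_of_costate hC h1 h2 _ _).1 hopt
  have hT0 : 0 < T := two_pos.trans hT
  obtain ⟨w, hw, hp, htraj⟩ := exists_optimality_trajectory hB hT0 h1 h2 x₀ x₁
  set y := fun t => linFlow (hamiltonian (mulVL A) (mulVL B) (mulVL C)) t w with hy
  have hyc : Continuous y :=
    continuous_iff_continuousAt.2 fun t => (hasDerivAt_linFlow _ w t).continuousAt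
  obtain ⟨ho, huniq⟩ := isOptimalPair_of_costate hT0.le (by fun_prop) hp htraj
  refine ⟨_, _, ho, by fun_prop, huniq, fun t ht => ?_⟩
  have hyt := hbound T hT.le w t ht
  rw [hw] at hyt
  set g := Real.exp (-μ * t) + Real.exp (-μ * (T - t)) with hg
  have hg0 : 0 ≤ g := by positivity
  have e1 : -(ContinuousLinearMap.adjoint (mulVL B) (pb + (y t).2)) -
      -(ContinuousLinearMap.adjoint (mulVL B) pb) =
      -(ContinuousLinearMap.adjoint (mulVL B) (y t).2) := by rw [map_add]; abel
  rw [e1, norm_neg, add_sub_cancel_left]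
  have b1 : ‖ContinuousLinearMap.adjoint (mulVL B) (y t).2‖ ≤ β * ‖y t‖ :=
    (ContinuousLinearMap.le_opNorm _ _).trans
      (mul_le_mul_of_nonneg_left (norm_snd_le _) hβ0)
  have b2 : ‖(y t).1‖ ≤ ‖y t‖ := norm_fst_le _
  calc _ ≤ (β + 1) * ‖y t‖ := by linarith
    _ ≤ (β + 1) * (K * ‖(x₀ - xbar, x₁ - xbar)‖ * g) :=
        mul_le_mul_of_nonneg_left hyt (by positivity)
    _ ≤ ((β + 1) * (K * ‖(x₀ - xbar, x₁ - xbar)‖) + 1) * g := by nlinarith
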